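/- Let $\mathbb D=\{z\in\mathbb C:|z|<1\}$, and let $\mathcal A$ be the class of analytic functions $f$ on $\mathbb D$ of the form $f(z)=z+\sum_{n\ge 2}a_nz^n$. For analytic functions $h,g$ on $\mathbb D$ write $h\prec g$ if $h(z)=g(w(z))$ on $\mathbb D$ for some analytic $w:\mathbb D\to\mathbb C$ with $w(0)=0$ and $|w(z)|\le|z|$. Let $\mathcal C_{\mathcal B}$ be the class of all $f\in\mathcal A$ with $f'\neq 0$ on $\mathbb D$ and $$1+\frac{zf''(z)}{f'(z)}\prec\sqrt{1+\tanh z},$$ where the square root is the principal branch. For $f\in\mathcal A$ let $$H_2(3)=\begin{vmatrix}a_3&a_4\\a_4&a_5\end{vmatrix}=a_3a_5-a_4^2 .$$ **Theorem.** For every $f\in\mathcal C_{\mathcal B}$, one has $|H_2(3)|\le \dfrac1{576}$. The bound is sharp: the function $$f_1(z)=\int_0^z\exp\left(\int_0^t\frac{\sqrt{1+\tanh u^3}-1}{u}\,du\right)dt$$ belongs to $\mathcal C_{\mathcal B}$, and for $f=f_1$ one has $|H_2(3)|=\dfrac1{576}$. -/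

import Mathlib

namespace BeanConvex

/-- The open unit disk `𝔻` in `ℂ`. -/
def unitDisk : Set ℂ := Metric.ball (0 : ℂ) 1

/-- The class `𝒜` of analytic functions on the unit disk, normalized by `f 0 = 0`, `f' 0 = 1`,
that is, with an expansion `f z = z + a₂ z² + a₃ z³ + ⋯`. -/
def classA : Set (ℂ → ℂ) :=
  {f | DifferentiableOn ℂ f unitDisk ∧ f 0 = 0 ∧ deriv f 0 = 1}

/-- The `n`-th Taylor coefficient `a_n` of `f` at the origin. -/
noncomputable def coeff (f : ℂ → ℂ) (n : ℕ) : ℂ :=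
  iteratedDeriv n f 0 / (n.factorial : ℂ)

/-- The Hankel determinant `H_q(n)`: the determinant of the `q × q` matrix with entries
`a_{n+i+j}`, `0 ≤ i, j < q`. -/
noncomputable def hankelDet (f : ℂ → ℂ) (q n : ℕ) : ℂ :=
  (Matrix.of fun i j : Fin q => coeff f (n + (i : ℕ) + (j : ℕ))).det

theorem hankelDet_two_three (f : ℂ → ℂ) :
    hankelDet f 2 3 = coeff f 3 * coeff f 5 - coeff f 4 ^ 2 := by
  simp [hankelDet, Matrix.det_fin_two, sq]

/-- A Schwarz function: analytic on the unit disk, with `w 0 = 0` and `|w z| ≤ |z|` there. -/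
def IsSchwarz (w : ℂ → ℂ) : Prop :=
  DifferentiableOn ℂ w unitDisk ∧ w 0 = 0 ∧ ∀ z ∈ unitDisk, ‖w z‖ ≤ ‖z‖

/-- Subordination `h ≺ g` of analytic functions on the unit disk: `h = g ∘ w` on the disk for
some Schwarz function `w`. -/
def Subordinate (h g : ℂ → ℂ) : Prop :=
  DifferentiableOn ℂ h unitDisk ∧ DifferentiableOn ℂ g unitDisk ∧
    ∃ w : ℂ → ℂ, IsSchwarz w ∧ ∀ z ∈ unitDisk, h z = g (w z)

/-- The bean function `z ↦ √(1 + tanh z)`, with the principal square root. For `|z| < 1` the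
number `1 + tanh z` lies off the closed negative real axis, so that this is the analytic branch
with value `1` at the origin. -/
noncomputable def bean (z : ℂ) : ℂ := Complex.sqrt (1 + Complex.tanh z)

/-- The class `𝒞_ℬ` of all `f ∈ 𝒜` with `1 + z f''(z) / f'(z) ≺ √(1 + tanh z)`. The condition
that `f'` has no zero in the disk is what gives the quotient a meaning as an analytic function. -/
def classCB : Set (ℂ → ℂ) :=
  {f | f ∈ classA ∧ (∀ z ∈ unitDisk, deriv f z ≠ 0) ∧
    Subordinate (fun z => 1 + z * deriv (deriv f) z / deriv f z) bean}

/-- The integral `∫₀ᶻ g(t) dt` along the segment from `0` to `z`. -/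
noncomputable def segIntegral (g : ℂ → ℂ) (z : ℂ) : ℂ :=
  ∫ s in (0 : ℝ)..1, z * g ((s : ℂ) * z)

/-- The function
`f₁(z) = ∫₀ᶻ exp (∫₀ᵗ (√(1 + tanh u³) - 1) / u du) dt`. -/
noncomputable def extremalFun (z : ℂ) : ℂ :=
  segIntegral
    (fun t => Complex.exp (segIntegral (fun u => (bean (u ^ 3) - 1) / u) t)) z

end BeanConvex

/-!
Since `bean² = 1 + tanh` and `tanh' = 1 - tanh²`, the bean function solves
`2 b' = b (2 - b²)`. For `f ∈ 𝒞_ℬ` with Schwarz function `w`, the function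
`p = 1 + z f'' / f' = bean ∘ w` therefore satisfies `2 p' = p (2 - p²) w'`. Comparing coefficients,
first here and then in `z f'' = (p - 1) f'`, writes `a₃`, `a₄`, `a₅` as polynomials in the Taylor
coefficients `b₁, …, b₄` of `w`. Because `|w| ≤ 1`, Parseval's identity gives
`|b₁|² + |b₂|² + |b₃|² + |b₄|² ≤ 1`, and under this constraint alone the triangle inequality
reduces `576 |a₃ a₅ - a₄²| ≤ 1` to a polynomial inequality in the `|bₖ|`. For `w = z³` only `b₃ = 1`
survives, so that `a₃ = a₅ = 0` and `a₄ = 1 / 24`.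
-/

namespace BeanConvex

open Filter Metric Set Topology
open scoped PowerSeries

section FormalPowerSeries

variable {K : Type*} [Field K] [CharZero K]

theorem coeff_of_X_mul_derivative_eq {P D : K⟦X⟧} (hP : P.constantCoeff = 1)
    (hD : D.constantCoeff = 1)
    (h : PowerSeries.X * PowerSeries.derivative K D = (P - 1) * D) :
    D.coeff 2 = (P.coeff 1 ^ 2 + P.coeff 2) / 2 ∧
    D.coeff 3 = (P.coeff 1 ^ 3 + 3 * P.coeff 1 * P.coeff 2 + 2 * P.coeff 3) / 6 ∧
    D.coeff 4 = (P.coeff 1 ^ 4 + 6 * P.coeff 1 ^ 2 * P.coeff 2 + 3 * P.coeff 2 ^ 2 +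
      8 * P.coeff 1 * P.coeff 3 + 6 * P.coeff 4) / 24 := by
  have recurrence (n : ℕ) := congrArg (PowerSeries.coeff (n + 1)) h
  simp only [PowerSeries.coeff_succ_X_mul] at recurrence
  simp only [PowerSeries.coeff_derivative, PowerSeries.coeff_mul, map_sub,
    PowerSeries.coeff_one] at recurrence
  have h1 := recurrence 0
  have h2 := recurrence 1
  have h3 := recurrence 2
  have h4 := recurrence 3
  norm_num [Finset.Nat.antidiagonal_succ, hP, hD] at h1 h2 h3 h4
  rw [h1] at h2 h3 h4
  have d2 : D.coeff 2 = (P.coeff 1 ^ 2 + P.coeff 2) / 2 := by linear_combination h2 / 2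
  rw [d2] at h3 h4
  have d3 : D.coeff 3 = (P.coeff 1 ^ 3 + 3 * P.coeff 1 * P.coeff 2 + 2 * P.coeff 3) / 6 := by
    linear_combination h3 / 3
  rw [d3] at h4
  exact ⟨d2, d3, by linear_combination h4 / 4⟩

theorem coeff_of_two_mul_derivative_eq {P W : K⟦X⟧} (hP : P.constantCoeff = 1)
    (h : 2 * PowerSeries.derivative K P = P * (2 - P ^ 2) * PowerSeries.derivative K W) :
    P.coeff 1 = W.coeff 1 / 2 ∧
    P.coeff 2 = W.coeff 2 / 2 - W.coeff 1 ^ 2 / 8 ∧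
    P.coeff 3 = W.coeff 3 / 2 - W.coeff 1 * W.coeff 2 / 4 - 5 / 48 * W.coeff 1 ^ 3 ∧
    P.coeff 4 = W.coeff 4 / 2 - W.coeff 1 * W.coeff 3 / 4 - W.coeff 2 ^ 2 / 8 -
      5 / 16 * W.coeff 1 ^ 2 * W.coeff 2 + 17 / 384 * W.coeff 1 ^ 4 := by
  rw [← map_ofNat PowerSeries.C 2, sq] at h
  have recurrence (n : ℕ) := congrArg (PowerSeries.coeff n) h
  simp only [PowerSeries.coeff_C_mul] at recurrence
  simp only [PowerSeries.coeff_derivative, PowerSeries.coeff_mul, map_sub,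
    PowerSeries.coeff_C] at recurrence
  have h1 := recurrence 0
  have h2 := recurrence 1
  have h3 := recurrence 2
  have h4 := recurrence 3
  norm_num [Finset.Nat.antidiagonal_succ, hP] at h1 h2 h3 h4
  have p1 : P.coeff 1 = W.coeff 1 / 2 := by linear_combination h1 / 2
  rw [p1] at h2 h3 h4
  have p2 : P.coeff 2 = W.coeff 2 / 2 - W.coeff 1 ^ 2 / 8 := by linear_combination h2 / 4
  rw [p2] at h3 h4
  have p3 : P.coeff 3 = W.coeff 3 / 2 - W.coeff 1 * W.coeff 2 / 4 - 5 / 48 * W.coeff 1 ^ 3 := by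
    linear_combination h3 / 6
  rw [p3] at h4
  exact ⟨p1, p2, p3, by linear_combination h4 / 8⟩

end FormalPowerSeries

section TaylorSeries

/-- The Taylor series of `f` at the origin as a formal power series, through which differential
equations become recurrences for the Taylor coefficients. -/
noncomputable def taylorSeries (f : ℂ → ℂ) : ℂ⟦X⟧ := PowerSeries.mk (coeff f)

variable {f g p w : ℂ → ℂ}

@[simp]
theorem coeff_taylorSeries (f : ℂ → ℂ) (n : ℕ) : (taylorSeries f).coeff n = coeff f n :=
  PowerSeries.coeff_mk n _

@[simp]
theorem constantCoeff_taylorSeries (f : ℂ → ℂ) : (taylorSeries f).constantCoeff = f 0 := by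
  simp [← PowerSeries.coeff_zero_eq_constantCoeff_apply, coeff]

theorem taylorSeries_congr (h : f =ᶠ[𝓝 0] g) : taylorSeries f = taylorSeries g := by
  ext n
  simp [coeff, h.iteratedDeriv_eq]

theorem taylorSeries_const (a : ℂ) : taylorSeries (fun _ => a) = PowerSeries.C a := by
  ext n
  rcases n with _ | n <;> simp [coeff, iteratedDeriv_const, PowerSeries.coeff_C]

theorem coeff_pow (m n : ℕ) : coeff (fun z => z ^ m) n = if n = m then 1 else 0 := by
  rw [coeff, iteratedDeriv_fun_pow_zero]
  split_ifs with h
  · simp [h, Nat.factorial_ne_zero]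
  · simp

theorem taylorSeries_id : taylorSeries (fun z => z) = PowerSeries.X := by
  ext n
  simpa [PowerSeries.coeff_X] using coeff_pow 1 n

theorem taylorSeries_mul (hf : AnalyticAt ℂ f 0) (hg : AnalyticAt ℂ g 0) :
    taylorSeries (fun z => f z * g z) = taylorSeries f * taylorSeries g := by
  ext n
  simp only [coeff_taylorSeries, coeff, iteratedDeriv_fun_mul hf.contDiffAt hg.contDiffAt,
    PowerSeries.coeff_mul, Finset.Nat.sum_antidiagonal_eq_sum_range_succ_mk, Finset.sum_div]
  refine Finset.sum_congr rfl fun i hi ↦ ?_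
  rw [Nat.cast_choose _ (Finset.mem_range_succ_iff.1 hi)]
  field_simp [Nat.factorial_ne_zero]

theorem taylorSeries_sub (hf : AnalyticAt ℂ f 0) (hg : AnalyticAt ℂ g 0) :
    taylorSeries (fun z => f z - g z) = taylorSeries f - taylorSeries g := by
  ext n
  simp [coeff, iteratedDeriv_fun_sub hf.contDiffAt hg.contDiffAt, sub_div]

theorem coeff_deriv (f : ℂ → ℂ) (n : ℕ) : coeff (deriv f) n = coeff f (n + 1) * (n + 1) := by
  have h : (n : ℂ) + 1 ≠ 0 := n.cast_add_one_ne_zero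
  simp only [coeff, iteratedDeriv_succ', Nat.factorial_succ, Nat.cast_mul, Nat.cast_succ]
  field_simp

theorem taylorSeries_deriv (f : ℂ → ℂ) :
    taylorSeries (deriv f) = PowerSeries.derivative ℂ (taylorSeries f) := by
  ext n
  simp [coeff_deriv, PowerSeries.coeff_derivative]

theorem coeff_of_mul_deriv_deriv_eq (hf : AnalyticAt ℂ f 0) (hp : AnalyticAt ℂ p 0)
    (hf1 : deriv f 0 = 1) (hp0 : p 0 = 1)
    (h : ∀ᶠ z in 𝓝 0, z * deriv (deriv f) z = (p z - 1) * deriv f z) :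
    coeff f 3 = (coeff p 1 ^ 2 + coeff p 2) / 6 ∧
    coeff f 4 = (coeff p 1 ^ 3 + 3 * coeff p 1 * coeff p 2 + 2 * coeff p 3) / 24 ∧
    coeff f 5 = (coeff p 1 ^ 4 + 6 * coeff p 1 ^ 2 * coeff p 2 + 3 * coeff p 2 ^ 2 +
      8 * coeff p 1 * coeff p 3 + 6 * coeff p 4) / 120 := by
  have formal := taylorSeries_congr h
  rw [taylorSeries_mul (differentiable_fun_id.analyticAt 0) hf.deriv.deriv,
    taylorSeries_mul (hp.fun_sub analyticAt_const) hf.deriv, taylorSeries_id,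
    taylorSeries_sub hp analyticAt_const, taylorSeries_const, map_one,
    taylorSeries_deriv (deriv f)] at formal
  obtain ⟨d2, d3, d4⟩ := coeff_of_X_mul_derivative_eq (by simpa) (by simpa) formal
  simp only [coeff_taylorSeries, coeff_deriv] at d2 d3 d4
  norm_num at d2 d3 d4
  exact ⟨by linear_combination d2 / 3, by linear_combination d3 / 4,
    by linear_combination d4 / 5⟩

theorem coeff_of_two_mul_deriv_eq (hp : AnalyticAt ℂ p 0) (hw : AnalyticAt ℂ w 0)
    (hp0 : p 0 = 1) (h : ∀ᶠ z in 𝓝 0, 2 * deriv p z = p z * (2 - p z * p z) * deriv w z) :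
    coeff p 1 = coeff w 1 / 2 ∧
    coeff p 2 = coeff w 2 / 2 - coeff w 1 ^ 2 / 8 ∧
    coeff p 3 = coeff w 3 / 2 - coeff w 1 * coeff w 2 / 4 - 5 / 48 * coeff w 1 ^ 3 ∧
    coeff p 4 = coeff w 4 / 2 - coeff w 1 * coeff w 3 / 4 - coeff w 2 ^ 2 / 8 -
      5 / 16 * coeff w 1 ^ 2 * coeff w 2 + 17 / 384 * coeff w 1 ^ 4 := by
  have formal := taylorSeries_congr h
  rw [taylorSeries_mul analyticAt_const hp.deriv,
    taylorSeries_mul (hp.fun_mul (analyticAt_const.fun_sub (hp.fun_mul hp))) hw.deriv,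
    taylorSeries_mul hp (analyticAt_const.fun_sub (hp.fun_mul hp)),
    taylorSeries_sub analyticAt_const (hp.fun_mul hp), taylorSeries_mul hp hp, taylorSeries_const,
    taylorSeries_deriv, taylorSeries_deriv, map_ofNat, ← sq] at formal
  simpa only [coeff_taylorSeries] using coeff_of_two_mul_derivative_eq (by simpa) formal

end TaylorSeries

section RealInequality

variable {c x u v : ℝ}

theorem hankel_cross_term_le (hc : 0 ≤ c) (h : c ^ 2 + x ^ 2 + u ^ 2 ≤ 1) :
    70 * u + 18 * c + 48 * c ^ 3 + 77 * (c * x) ≤ 122 := by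
  have hc1 : c ≤ 1 := by nlinarith only [h, sq_nonneg x, sq_nonneg u]
  have hcube : c ^ 3 ≤ c := pow_le_of_le_one hc hc1 three_ne_zero
  have hcx : 77 * (c * x) ≤ 77 / 2 * (c ^ 2 + x ^ 2) := by linarith [two_mul_le_add_sq c x]
  have hlin : 66 * c ≤ 75 / 2 * c ^ 2 + 59 / 2 := by nlinarith only [sq_nonneg (c - 22 / 25)]
  have hu : 70 * u ≤ 76 * u ^ 2 + 33 / 2 := by nlinarith only [sq_nonneg (u - 35 / 76)]
  linarith [sq_nonneg x]

theorem hankel_poly_le_one (hc : 0 ≤ c) (hx : 0 ≤ x) (h : c ^ 2 + x ^ 2 + u ^ 2 + v ^ 2 ≤ 1) :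
    3 / 5 * (4 * x + c ^ 2) * (v / 2 + c * u / 12 + 5 / 12 * c ^ 2 * x + 11 / 288 * c ^ 4) +
      (u + c * x / 4 + 13 / 48 * c ^ 3) ^ 2 ≤ 1 := by
  have hc1 : c ≤ 1 := by nlinarith only [h, sq_nonneg x, sq_nonneg u, sq_nonneg v]
  have hcu : 2 * (c * u) ≤ 1 - x ^ 2 := by linarith [two_mul_le_add_sq c u, sq_nonneg v]
  have cross := hankel_cross_term_le (x := x) (u := u) hc (by linarith [sq_nonneg v])
  have hcube_u : c ^ 2 * (2 * (c * u)) ≤ c ^ 2 * (1 - x ^ 2) := by gcongr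
  have hcross : c * x * (70 * u + 18 * c + 48 * c ^ 3 + 77 * (c * x)) ≤ c * x * 122 := by gcongr
  have hc4 : c ^ 4 ≤ c ^ 2 := pow_le_pow_of_le_one hc hc1 (by norm_num)
  have hc6 : c ^ 6 ≤ c ^ 2 := pow_le_pow_of_le_one hc hc1 (by norm_num)
  have hc4x : 0 ≤ c ^ 4 * x := by positivity
  -- The first square absorbs the terms `v * x` and `v * c ^ 2`; the multiple `c * x` of the `cross`
  -- bound that remains is then absorbed by the second.
  linarith [sq_nonneg (v - 3 / 5 * x - 3 / 20 * c ^ 2), sq_nonneg (4 / 5 * x - 61 / 80 * c),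
    sq_nonneg (c * x), sq_nonneg c]

end RealInequality

section Parseval

open MeasureTheory Real

variable {f : ℂ → ℂ} {r : ℝ}

theorem circleAverage_inv_pow_mul (hr : 0 < r) (hf : DifferentiableOn ℂ f (closedBall 0 r))
    (n : ℕ) : circleAverage (fun z => (z ^ n)⁻¹ * f z) 0 r = coeff f n := by
  have cauchy := hf.circleIntegral_one_div_sub_center_pow_smul hr n
  have integrand (z : ℂ) :
      (z - 0)⁻¹ • ((z ^ n)⁻¹ * f z) = (1 / (z - 0) ^ (n + 1)) • f z := by
    simp only [sub_zero, smul_eq_mul, one_div, pow_succ, mul_inv]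
    ring
  simp only [circleAverage_eq_circleIntegral hr.ne', integrand]
  rw [cauchy, coeff, smul_eq_mul, smul_eq_mul]
  field_simp [Complex.two_pi_I_ne_zero]

theorem fourierCoeffOn_circleMap (hr : 0 < r) (hf : DifferentiableOn ℂ f (closedBall 0 r))
    (n : ℕ) :
    fourierCoeffOn two_pi_pos (fun θ => f (circleMap 0 r θ)) n = coeff f n * r ^ n := by
  have character (θ : ℝ) : fourier (-(n : ℤ)) (θ : AddCircle (2 * π - 0)) =
      (r : ℂ) ^ n * (circleMap 0 r θ ^ n)⁻¹ := by
    have hr' : (r : ℂ) ≠ 0 := by exact_mod_cast hr.ne'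
    rw [fourier_coe_apply, circleMap_zero, mul_pow, mul_inv, mul_inv_cancel_left₀ (by positivity),
      ← Complex.exp_nat_mul, ← Complex.exp_neg]
    congr 1
    push_cast
    field_simp
    ring
  rw [fourierCoeffOn_eq_integral, ← circleAverage_inv_pow_mul hr hf, circleAverage_def]
  simp only [character, smul_eq_mul, mul_assoc, intervalIntegral.integral_const_mul]
  simp only [one_div, sub_zero, Complex.real_smul]
  ring

theorem sum_sq_norm_coeff_mul_le_circleAverage (hr : 0 < r)
    (hf : DifferentiableOn ℂ f (closedBall 0 r)) (s : Finset ℕ) :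
    ∑ k ∈ s, (‖coeff f k‖ * r ^ k) ^ 2 ≤ circleAverage (fun z => ‖f z‖ ^ 2) 0 r := by
  have hcont : Continuous fun θ => f (circleMap 0 r θ) :=
    hf.continuousOn.comp_continuous (continuous_circleMap 0 r) (circleMap_mem_closedBall 0 hr.le)
  have hL2 : MemLp (fun θ => f (circleMap 0 r θ)) 2 (volume.restrict (Ioc 0 (2 * π))) :=
    (memLp_two_iff_integrable_sq_norm hcont.aestronglyMeasurable).2
      ((hcont.norm.pow 2).intervalIntegrable 0 (2 * π)).1
  have parseval := hasSum_sq_fourierCoeffOn two_pi_pos hL2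
  have bessel := sum_le_hasSum (s.map Nat.castEmbedding) (fun _ _ => sq_nonneg _) parseval
  rw [Finset.sum_map] at bessel
  simpa [fourierCoeffOn_circleMap hr hf, circleAverage_def, abs_of_pos hr] using bessel

theorem sum_sq_norm_coeff_le_one (hf : DifferentiableOn ℂ f unitDisk)
    (hbound : ∀ z ∈ unitDisk, ‖f z‖ ≤ 1) (s : Finset ℕ) : ∑ k ∈ s, ‖coeff f k‖ ^ 2 ≤ 1 := by
  have hlim : Tendsto (fun r : ℝ => ∑ k ∈ s, (‖coeff f k‖ * r ^ k) ^ 2) (𝓝[<] 1)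
      (𝓝 (∑ k ∈ s, (‖coeff f k‖ * 1 ^ k) ^ 2)) :=
    (Continuous.tendsto (by fun_prop) 1).mono_left nhdsWithin_le_nhds
  simp only [one_pow, mul_one] at hlim
  refine le_of_tendsto hlim ?_
  filter_upwards [Ioo_mem_nhdsLT (zero_lt_one' ℝ)] with r hr
  have hsub : closedBall (0 : ℂ) r ⊆ unitDisk := closedBall_subset_ball hr.2
  have hcirc : sphere (0 : ℂ) |r| ⊆ unitDisk := by
    rw [abs_of_pos hr.1]
    exact sphere_subset_closedBall.trans hsub
  refine (sum_sq_norm_coeff_mul_le_circleAverage hr.1 (hf.mono hsub) s).trans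
    (circleAverage_mono_on_of_le_circle ?_ fun z hz =>
      pow_le_one₀ (norm_nonneg _) (hbound z (hcirc hz)))
  exact ((hf.continuousOn.mono hcirc).norm.pow 2).circleIntegrable'

end Parseval

section Bean

open Complex

variable {z : ℂ}

theorem abs_im_lt_pi_div_two (hz : z ∈ unitDisk) : |z.im| < Real.pi / 2 := by
  have := (abs_im_le_norm z).trans_lt (mem_ball_zero_iff.1 hz)
  linarith [Real.pi_gt_three]

theorem one_add_exp_neg_two_mul_mem_slitPlane (hz : |z.im| < Real.pi / 2) :
    1 + exp (-2 * z) ∈ slitPlane := by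
  obtain ⟨hlower, hupper⟩ := abs_lt.1 hz
  have hexp : exp (-2 * z) ∈ slitPlane := by
    refine expOpenPartialHomeomorph.map_source (x := -2 * z) ⟨?_, ?_⟩ <;>
      simp only [mul_im, neg_re, neg_im, re_ofNat, im_ofNat] <;> linarith
  rw [mem_slitPlane_iff] at hexp ⊢
  simp only [add_re, add_im, one_re, one_im, zero_add]
  exact hexp.imp_left fun h => by linarith

theorem cosh_eq_exp_mul_one_add_exp (z : ℂ) : cosh z = exp z * (1 + exp (-2 * z)) / 2 := by
  rw [mul_one_add, ← Complex.exp_add, show z + -2 * z = -z by ring, cosh]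

theorem cosh_ne_zero_of_abs_im_lt (hz : |z.im| < Real.pi / 2) : cosh z ≠ 0 := by
  have hexp := slitPlane_ne_zero (one_add_exp_neg_two_mul_mem_slitPlane hz)
  rw [cosh_eq_exp_mul_one_add_exp]
  exact div_ne_zero (mul_ne_zero (exp_ne_zero z) hexp) two_ne_zero

theorem one_add_tanh_eq (hz : cosh z ≠ 0) : 1 + tanh z = (2 : ℝ) * (1 + exp (-2 * z))⁻¹ := by
  rw [tanh_eq_sinh_div_cosh, one_add_div hz, cosh_add_sinh, cosh_eq_exp_mul_one_add_exp]
  field_simp [exp_ne_zero z]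
  norm_num

theorem inv_mem_slitPlane (hz : z ∈ slitPlane) : z⁻¹ ∈ slitPlane := by
  have harg := slitPlane_arg_ne_pi hz
  rw [mem_slitPlane_iff_arg, arg_inv, if_neg harg]
  exact ⟨by linarith [neg_pi_lt_arg z], inv_ne_zero (slitPlane_ne_zero hz)⟩

theorem ofReal_mul_mem_slitPlane {t : ℝ} (ht : 0 < t) (hz : z ∈ slitPlane) :
    t * z ∈ slitPlane := by
  rw [mem_slitPlane_iff_arg] at hz ⊢
  rw [arg_real_mul z ht]
  exact ⟨hz.1, mul_ne_zero (ofReal_ne_zero.2 ht.ne') hz.2⟩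

theorem one_add_tanh_mem_slitPlane (hz : |z.im| < Real.pi / 2) : 1 + tanh z ∈ slitPlane := by
  rw [one_add_tanh_eq (cosh_ne_zero_of_abs_im_lt hz)]
  exact ofReal_mul_mem_slitPlane two_pos
    (inv_mem_slitPlane (one_add_exp_neg_two_mul_mem_slitPlane hz))

theorem hasDerivAt_tanh (hz : cosh z ≠ 0) : HasDerivAt tanh (1 - tanh z ^ 2) z := by
  have h := (hasDerivAt_sinh z).div (hasDerivAt_cosh z) hz
  rw [show tanh = sinh / cosh from funext tanh_eq_sinh_div_cosh]
  refine h.congr_deriv ?_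
  simp only [Pi.div_apply]
  field_simp

theorem bean_zero : bean 0 = 1 := by simp [bean]

theorem bean_sq (z : ℂ) : bean z ^ 2 = 1 + tanh z := by
  rw [bean, Complex.sqrt]
  exact_mod_cast cpow_nat_inv_pow (1 + tanh z) two_ne_zero

theorem hasDerivAt_bean (hz : |z.im| < Real.pi / 2) :
    HasDerivAt bean (bean z * (2 - bean z ^ 2) / 2) z := by
  have hslit := one_add_tanh_mem_slitPlane hz
  have htanh := (hasDerivAt_tanh (cosh_ne_zero_of_abs_im_lt hz)).const_add 1
  have hbean : bean z ≠ 0 := fun h =>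
    slitPlane_ne_zero hslit (by rw [← bean_sq, h, zero_pow two_ne_zero])
  have hderiv : HasDerivAt bean (deriv bean z) z :=
    ((differentiableAt_sqrt hslit).comp z htanh.differentiableAt).hasDerivAt
  have hsq : 2 * bean z * deriv bean z = 1 - (bean z ^ 2 - 1) ^ 2 := by
    have h := (hderiv.fun_pow 2).unique (htanh.congr_of_eventuallyEq (.of_forall bean_sq))
    simpa [bean_sq] using h
  convert hderiv using 1
  apply mul_left_cancel₀ hbean
  linear_combination -hsq / 2

theorem differentiableOn_bean : DifferentiableOn ℂ bean unitDisk := fun _ hz =>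
  (hasDerivAt_bean (abs_im_lt_pi_div_two hz)).differentiableAt.differentiableWithinAt

end Bean

section SegmentIntegral

variable {f g G φ : ℂ → ℂ} {s : Set ℂ} {z : ℂ} {R : ℝ}

theorem segIntegral_eq_sub (hs : StarConvex ℝ 0 s) (hG : ∀ z ∈ s, HasDerivAt G (g z) z)
    (hg : ContinuousOn g s) (hz : z ∈ s) : segIntegral g z = G z - G 0 := by
  have segment_subset : ∀ t ∈ uIcc (0 : ℝ) 1, (t : ℂ) * z ∈ s := by
    intro t ht
    rw [uIcc_of_le zero_le_one] at ht
    simpa using hs.smul_mem hz ht.1 ht.2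
  have hsegment (t : ℝ) : HasDerivAt (fun t : ℝ => (t : ℂ) * z) z t := by
    simpa using (Complex.ofRealCLM.hasDerivAt (x := t)).mul_const z
  have ftc := intervalIntegral.integral_eq_sub_of_hasDerivAt
    (fun t ht => ((hG _ (segment_subset t ht)).comp t (hsegment t)).congr_deriv (mul_comm _ _))
    (continuousOn_const.mul (hg.comp (by fun_prop) segment_subset)).intervalIntegrable
  simpa [segIntegral] using ftc

theorem hasDerivAt_segIntegral (hg : DifferentiableOn ℂ g (ball 0 R)) (hz : z ∈ ball 0 R) :
    HasDerivAt (segIntegral g) (g z) z := by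
  obtain ⟨G, hG⟩ := hg.isExactOn_ball
  have star : StarConvex ℝ (0 : ℂ) (ball 0 R) :=
    (convex_ball 0 R).starConvex (mem_ball_self (pos_of_mem_ball hz))
  refine ((hG z hz).sub_const (G 0)).congr_of_eventuallyEq ?_
  filter_upwards [isOpen_ball.mem_nhds hz] with y hy
  exact segIntegral_eq_sub star hG hg.continuousOn hy

@[simp]
theorem segIntegral_zero (g : ℂ → ℂ) : segIntegral g 0 = 0 := by simp [segIntegral]

theorem segIntegral_congr_of_ne_zero (h : ∀ z ≠ 0, f z = g z) : segIntegral f = segIntegral g := by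
  funext z
  rcases eq_or_ne z 0 with rfl | hz
  · simp
  refine intervalIntegral.integral_congr_ae (.of_forall fun t ht => ?_)
  rw [uIoc_of_le zero_le_one] at ht
  rw [h _ (mul_ne_zero (Complex.ofReal_ne_zero.2 ht.1.ne') hz)]

/-- The normalized solution `f` of `1 + z f''(z) / f'(z) = φ(z)`, where `φ 0 = 1`. -/
noncomputable def convexSolution (φ : ℂ → ℂ) (z : ℂ) : ℂ :=
  segIntegral (fun t => Complex.exp (segIntegral (fun u => (φ u - 1) / u) t)) z

theorem hasDerivAt_segIntegral_sub_one_div (hφ : DifferentiableOn ℂ φ (ball 0 R)) (hφ0 : φ 0 = 1)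
    (hz : z ∈ ball 0 R) :
    HasDerivAt (segIntegral fun u => (φ u - 1) / u) (dslope φ 0 z) z := by
  have hdslope : DifferentiableOn ℂ (dslope φ 0) (ball 0 R) :=
    (Complex.differentiableOn_dslope (ball_mem_nhds 0 (pos_of_mem_ball hz))).2 hφ
  rw [segIntegral_congr_of_ne_zero (g := dslope φ 0) fun u hu => by
    rw [dslope_of_ne _ hu, slope_def_field, hφ0, sub_zero]]
  exact hasDerivAt_segIntegral hdslope hz

theorem hasDerivAt_convexSolution (hφ : DifferentiableOn ℂ φ (ball 0 R)) (hφ0 : φ 0 = 1)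
    (hz : z ∈ ball 0 R) :
    HasDerivAt (convexSolution φ)
      (Complex.exp (segIntegral (fun u => (φ u - 1) / u) z)) z :=
  hasDerivAt_segIntegral (g := fun t => Complex.exp (segIntegral (fun u => (φ u - 1) / u) t))
    (fun _ hy => (hasDerivAt_segIntegral_sub_one_div hφ hφ0 hy).cexp.differentiableAt
      |>.differentiableWithinAt) hz

theorem deriv_convexSolution_ne_zero (hφ : DifferentiableOn ℂ φ (ball 0 R)) (hφ0 : φ 0 = 1)
    (hz : z ∈ ball 0 R) : deriv (convexSolution φ) z ≠ 0 := by
  rw [(hasDerivAt_convexSolution hφ hφ0 hz).deriv]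
  exact Complex.exp_ne_zero _

theorem one_add_mul_deriv_deriv_convexSolution_div (hφ : DifferentiableOn ℂ φ (ball 0 R))
    (hφ0 : φ 0 = 1) (hz : z ∈ ball 0 R) :
    1 + z * deriv (deriv (convexSolution φ)) z / deriv (convexSolution φ) z = φ z := by
  have hderiv2 : deriv (deriv (convexSolution φ)) z =
      deriv (convexSolution φ) z * dslope φ 0 z := by
    rw [(hasDerivAt_convexSolution hφ hφ0 hz).deriv]
    refine ((hasDerivAt_segIntegral_sub_one_div hφ hφ0 hz).cexp.congr_of_eventuallyEq ?_).deriv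
    filter_upwards [isOpen_ball.mem_nhds hz] with y hy
    exact (hasDerivAt_convexSolution hφ hφ0 hy).deriv
  have hslope : z * dslope φ 0 z = φ z - 1 := by simpa [hφ0] using sub_smul_dslope φ 0 z
  rw [hderiv2, mul_left_comm, mul_div_cancel_left₀ _ (deriv_convexSolution_ne_zero hφ hφ0 hz),
    hslope, add_sub_cancel]

end SegmentIntegral

section Subordination

variable {w : ℂ → ℂ}

theorem unitDisk_mem_nhds_zero : unitDisk ∈ 𝓝 (0 : ℂ) := ball_mem_nhds 0 one_pos

theorem IsSchwarz.mapsTo_unitDisk (hw : IsSchwarz w) : MapsTo w unitDisk unitDisk :=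
  fun z hz => mem_ball_zero_iff.2 ((hw.2.2 z hz).trans_lt (mem_ball_zero_iff.1 hz))

theorem isSchwarz_pow {n : ℕ} (hn : n ≠ 0) : IsSchwarz fun z => z ^ n :=
  ⟨by fun_prop, zero_pow hn, fun z hz => by
    rw [norm_pow]
    exact pow_le_of_le_one (norm_nonneg z) (mem_ball_zero_iff.1 hz).le hn⟩

theorem IsSchwarz.differentiableOn_bean_comp (hw : IsSchwarz w) :
    DifferentiableOn ℂ (fun z => bean (w z)) unitDisk :=
  differentiableOn_bean.comp hw.1 hw.mapsTo_unitDisk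

theorem IsSchwarz.bean_comp_zero (hw : IsSchwarz w) : bean (w 0) = 1 := by
  rw [hw.2.1, bean_zero]

theorem IsSchwarz.two_mul_deriv_bean_comp (hw : IsSchwarz w) {z : ℂ} (hz : z ∈ unitDisk) :
    2 * deriv (fun z => bean (w z)) z =
      bean (w z) * (2 - bean (w z) * bean (w z)) * deriv w z := by
  have hbean := hasDerivAt_bean (abs_im_lt_pi_div_two (hw.mapsTo_unitDisk hz))
  have hderiv := hbean.comp z (hw.1.differentiableAt (isOpen_ball.mem_nhds hz)).hasDerivAt
  rw [show deriv (fun z => bean (w z)) z = _ from hderiv.deriv]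
  ring

theorem convexSolution_bean_comp_mem_classCB (hw : IsSchwarz w) :
    convexSolution (fun z => bean (w z)) ∈ classCB := by
  have hφ := hw.differentiableOn_bean_comp
  have hφ0 := hw.bean_comp_zero
  have hderiv {z : ℂ} (hz : z ∈ unitDisk) := hasDerivAt_convexSolution hφ hφ0 hz
  have hquotient {z : ℂ} (hz : z ∈ unitDisk) :=
    one_add_mul_deriv_deriv_convexSolution_div hφ hφ0 hz
  refine ⟨⟨fun z hz => (hderiv hz).differentiableAt.differentiableWithinAt,
    segIntegral_zero _, ?_⟩, fun z hz => deriv_convexSolution_ne_zero hφ hφ0 hz,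
    hφ.congr fun z hz => hquotient hz, differentiableOn_bean, w, hw, fun z hz => hquotient hz⟩
  rw [(hderiv (mem_ball_self one_pos)).deriv, segIntegral_zero, Complex.exp_zero]

theorem extremalFun_eq_convexSolution :
    extremalFun = convexSolution fun z => bean (z ^ 3) := rfl

theorem extremalFun_mem_classCB : extremalFun ∈ classCB :=
  extremalFun_eq_convexSolution ▸
    convexSolution_bean_comp_mem_classCB (isSchwarz_pow three_ne_zero)

end Subordination

section Hankel

variable {f w : ℂ → ℂ}

theorem coeff_of_one_add_mul_deriv_deriv_div_eq_bean (hf : f ∈ classA)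
    (hf' : ∀ z ∈ unitDisk, deriv f z ≠ 0) (hw : IsSchwarz w)
    (h : ∀ z ∈ unitDisk, 1 + z * deriv (deriv f) z / deriv f z = bean (w z)) :
    coeff f 3 = (4 * coeff w 2 + coeff w 1 ^ 2) / 48 ∧
    coeff f 4 = (coeff w 3 + coeff w 1 * coeff w 2 / 4 - 13 / 48 * coeff w 1 ^ 3) / 24 ∧
    coeff f 5 = (coeff w 4 / 2 + coeff w 1 * coeff w 3 / 12 -
      5 / 12 * coeff w 1 ^ 2 * coeff w 2 - 11 / 288 * coeff w 1 ^ 4) / 20 := by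
  have hp := hw.differentiableOn_bean_comp.analyticAt unitDisk_mem_nhds_zero
  obtain ⟨p1, p2, p3, p4⟩ := coeff_of_two_mul_deriv_eq hp
    (hw.1.analyticAt unitDisk_mem_nhds_zero) hw.bean_comp_zero
    (by filter_upwards [unitDisk_mem_nhds_zero] with z hz using hw.two_mul_deriv_bean_comp hz)
  have ode : ∀ᶠ z in 𝓝 0, z * deriv (deriv f) z = (bean (w z) - 1) * deriv f z := by
    filter_upwards [unitDisk_mem_nhds_zero] with z hz
    rw [← h z hz, add_sub_cancel_left, div_mul_cancel₀ _ (hf' z hz)]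
  obtain ⟨f3, f4, f5⟩ := coeff_of_mul_deriv_deriv_eq
    (hf.1.analyticAt unitDisk_mem_nhds_zero) hp hf.2.2 hw.bean_comp_zero ode
  rw [f3, f4, f5, p1, p2, p3, p4]
  refine ⟨?_, ?_, ?_⟩ <;> ring

theorem hankelDet_two_three_eq (hf : f ∈ classA) (hf' : ∀ z ∈ unitDisk, deriv f z ≠ 0)
    (hw : IsSchwarz w)
    (h : ∀ z ∈ unitDisk, 1 + z * deriv (deriv f) z / deriv f z = bean (w z)) :
    576 * hankelDet f 2 3 =
      3 / 5 * (4 * coeff w 2 + coeff w 1 ^ 2) * (coeff w 4 / 2 + coeff w 1 * coeff w 3 / 12 -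
        5 / 12 * coeff w 1 ^ 2 * coeff w 2 - 11 / 288 * coeff w 1 ^ 4) -
      (coeff w 3 + coeff w 1 * coeff w 2 / 4 - 13 / 48 * coeff w 1 ^ 3) ^ 2 := by
  obtain ⟨f3, f4, f5⟩ := coeff_of_one_add_mul_deriv_deriv_div_eq_bean hf hf' hw h
  rw [hankelDet_two_three, f3, f4, f5]
  ring

theorem norm_hankel_poly_le (b₁ b₂ b₃ b₄ : ℂ) :
    ‖3 / 5 * (4 * b₂ + b₁ ^ 2) *
        (b₄ / 2 + b₁ * b₃ / 12 - 5 / 12 * b₁ ^ 2 * b₂ - 11 / 288 * b₁ ^ 4) -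
      (b₃ + b₁ * b₂ / 4 - 13 / 48 * b₁ ^ 3) ^ 2‖ ≤
    3 / 5 * (4 * ‖b₂‖ + ‖b₁‖ ^ 2) *
        (‖b₄‖ / 2 + ‖b₁‖ * ‖b₃‖ / 12 + 5 / 12 * ‖b₁‖ ^ 2 * ‖b₂‖ + 11 / 288 * ‖b₁‖ ^ 4) +
      (‖b₃‖ + ‖b₁‖ * ‖b₂‖ / 4 + 13 / 48 * ‖b₁‖ ^ 3) ^ 2 := by
  have h₃ : ‖4 * b₂ + b₁ ^ 2‖ ≤ 4 * ‖b₂‖ + ‖b₁‖ ^ 2 := (norm_add_le _ _).trans_eq (by simp)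
  have h₅ : ‖b₄ / 2 + b₁ * b₃ / 12 - 5 / 12 * b₁ ^ 2 * b₂ - 11 / 288 * b₁ ^ 4‖ ≤
      ‖b₄‖ / 2 + ‖b₁‖ * ‖b₃‖ / 12 + 5 / 12 * ‖b₁‖ ^ 2 * ‖b₂‖ + 11 / 288 * ‖b₁‖ ^ 4 := by
    refine (norm_sub_le_of_le (norm_sub_le_of_le (norm_add_le _ _) le_rfl) le_rfl).trans_eq ?_
    simp
  have h₄ : ‖b₃ + b₁ * b₂ / 4 - 13 / 48 * b₁ ^ 3‖ ≤
      ‖b₃‖ + ‖b₁‖ * ‖b₂‖ / 4 + 13 / 48 * ‖b₁‖ ^ 3 := by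
    refine (norm_sub_le_of_le (norm_add_le _ _) le_rfl).trans_eq ?_
    simp
  refine (norm_sub_le _ _).trans ?_
  rw [norm_mul, norm_mul, norm_pow, show ‖(3 / 5 : ℂ)‖ = 3 / 5 by simp]
  gcongr

theorem norm_hankelDet_le (hf : f ∈ classCB) : ‖hankelDet f 2 3‖ ≤ 1 / 576 := by
  obtain ⟨hfA, hf', -, -, w, hw, h⟩ := hf
  have parseval : ‖coeff w 1‖ ^ 2 + ‖coeff w 2‖ ^ 2 + ‖coeff w 3‖ ^ 2 + ‖coeff w 4‖ ^ 2 ≤ 1 := by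
    have bound := sum_sq_norm_coeff_le_one hw.1
      (fun z hz => (mem_ball_zero_iff.1 (hw.mapsTo_unitDisk hz)).le) (Finset.Ico 1 5)
    simpa [Finset.sum_Ico_succ_top] using bound
  have scaled : 576 * ‖hankelDet f 2 3‖ ≤ 1 := by
    calc 576 * ‖hankelDet f 2 3‖ = ‖576 * hankelDet f 2 3‖ := by simp
      _ ≤ _ := by
        rw [hankelDet_two_three_eq hfA hf' hw h]
        exact norm_hankel_poly_le _ _ _ _
      _ ≤ 1 := hankel_poly_le_one (norm_nonneg _) (norm_nonneg _) parseval
  linarith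

theorem norm_hankelDet_extremalFun : ‖hankelDet extremalFun 2 3‖ = 1 / 576 := by
  have hw := isSchwarz_pow three_ne_zero
  have h := hankelDet_two_three_eq extremalFun_mem_classCB.1 extremalFun_mem_classCB.2.1 hw
    fun z hz => extremalFun_eq_convexSolution ▸
      one_add_mul_deriv_deriv_convexSolution_div hw.differentiableOn_bean_comp
        hw.bean_comp_zero hz
  norm_num [coeff_pow] at h
  rw [show hankelDet extremalFun 2 3 = -(1 / 576) by linear_combination h / 576]
  norm_num

end Hankel

end BeanConvex

theorem mainTheorem4 :
    (∀ f ∈ BeanConvex.classCB, ‖BeanConvex.hankelDet f 2 3‖ ≤ 1 / 576) ∧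
      BeanConvex.extremalFun ∈ BeanConvex.classCB ∧
      ‖BeanConvex.hankelDet BeanConvex.extremalFun 2 3‖ = 1 / 576 :=
  ⟨fun _ hf => BeanConvex.norm_hankelDet_le hf, BeanConvex.extremalFun_mem_classCB,
    BeanConvex.norm_hankelDet_extremalFun⟩
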